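/- Let $G$ be a compact Lie group, let $K\in\{\mathbb R,\mathbb C,\mathbb H\}$, let $V$ be a finite-dimensional left $K$-vector space, and let $\rho$ be a continuous $K$-linear representation of $G$ on $V$ (for $K=\mathbb H$, a right vector space is regarded as a left one via $qv:=v\bar q$). Let $(G_n,\mathbb F^n)$ be one of the families of standard representations $(\mathrm{SO}(n),\mathbb R^n)$, $(\mathrm U(n),\mathbb C^n)$, $(\mathrm{Sp}(n),\mathbb H^n)$, where $G_n$ acts on column vectors by left multiplication, and let $\iota:K\to\mathbb F$ be a homomorphism of real algebras, which makes $\mathbb F^n$ a right $K$-vector space. (The case $K=\mathbb F$, $\iota=\mathrm{id}$ is the usual $\mathbb F$-tensor product of a representation of $\mathbb F$-type with the standard one.) Let $\rho(n)$ be the real representation of $G\times G_n$ on $\mathbb F^n\otimes_K V$ given by $(g,A)(w\otimes v)=Aw\otimes\rho(g)v$. Recall that the cohomogeneity of a real representation is the minimal codimension of its orbits. Then the cohomogeneity of $\rho(n)$ is eventually constant in $n$: there are $N,c\in\mathbb N$ such that $\rho(n)$ has cohomogeneity $c$ for all $n\ge N$. -/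

import Mathlib

open scoped TensorProduct Quaternion Manifold ContDiff

noncomputable section

namespace TensorCohomogeneity

section Cohomogeneity

variable {H : Type*} [Group H] [TopologicalSpace H] {W : Type*} [AddCommGroup W] [Module ℝ W]

/-- The tangent space at `p` of the orbit of `p` under a real representation `σ` of a Lie group `H`,
i.e. the image `𝔥 · p` of the Lie algebra `𝔥` of `H` under the differential at `1` of the orbit
map `h ↦ σ h p`. The elements of `𝔥` are the continuous one-parameter subgroups `φ : ℝ → H`, and the
image of `φ` is the velocity at `0` of the curve `t ↦ σ (φ t) p`. As `W` is a finite-dimensional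
vector space without a chosen norm, the derivative is taken coordinatewise: `w` is the derivative
when `ℓ w` is the derivative of the `ℓ`-coordinate for each linear functional `ℓ`. -/
def orbitTangent (σ : H →* Module.End ℝ W) (p : W) : Submodule ℝ W :=
  Submodule.span ℝ {w : W | ∃ φ : Multiplicative ℝ →* H, Continuous φ ∧
    ∀ ℓ : Module.Dual ℝ W,
      HasDerivAt (fun t : ℝ => ℓ (σ (φ (Multiplicative.ofAdd t)) p)) (ℓ w) 0}

/-- The codimension of the orbit through `p`. -/
def orbitCodim (σ : H →* Module.End ℝ W) (p : W) : ℕ :=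
  Module.finrank ℝ (W ⧸ orbitTangent σ p)

/-- The cohomogeneity of a representation: the minimal codimension of its orbits. -/
def cohomogeneity (σ : H →* Module.End ℝ W) : ℕ :=
  ⨅ p : W, orbitCodim σ p

end Cohomogeneity

section Tensor

variable {K F : Type*} [Ring K] [Algebra ℝ K] [Ring F] [Algebra ℝ F] (ι : K →ₐ[ℝ] F) (n : ℕ)
  (V : Type*) [AddCommGroup V] [Module ℝ V] [Module K V]

/-- The relations `(w q) ⊗ v = w ⊗ (q v)`, for `q` in `K`, `w` in `F ^ n` (a right `K`-module through
`ι : K → F`) and `v` in the left `K`-module `V`. -/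
def balancedRelations : Submodule ℝ ((Fin n → F) ⊗[ℝ] V) :=
  Submodule.span ℝ {x | ∃ (w : Fin n → F) (q : K) (v : V),
    x = (fun i => w i * ι q) ⊗ₜ[ℝ] v - w ⊗ₜ[ℝ] (q • v)}

/-- The tensor product `F ^ n ⊗_K V` of the right `K`-module `F ^ n` and the left `K`-module `V`, as a
real vector space. -/
abbrev StdTensor : Type _ := ((Fin n → F) ⊗[ℝ] V) ⧸ balancedRelations ι n V

variable {V} [IsScalarTower ℝ K V]

/-- The real linear map `A ⊗ f` of `F ^ n ⊗_ℝ V`, where `A` acts on column vectors on the left. -/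
def realTensorMap (A : Matrix (Fin n) (Fin n) F) (f : Module.End K V) :
    Module.End ℝ ((Fin n → F) ⊗[ℝ] V) :=
  TensorProduct.map
    { toFun := fun w => A.mulVec w
      map_add' := A.mulVec_add
      map_smul' := fun r w => A.mulVec_smul r w }
    (f.restrictScalars ℝ)

variable {n}

theorem realTensorMap_tmul (A : Matrix (Fin n) (Fin n) F) (f : Module.End K V) (w : Fin n → F)
    (v : V) : realTensorMap n A f (w ⊗ₜ[ℝ] v) = A.mulVec w ⊗ₜ[ℝ] f v := rfl

theorem balancedRelations_le_comap (A : Matrix (Fin n) (Fin n) F) (f : Module.End K V) :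
    balancedRelations ι n V ≤ (balancedRelations ι n V).comap (realTensorMap n A f) := by
  refine Submodule.span_le.2 ?_
  rintro _ ⟨w, q, v, rfl⟩
  refine Submodule.subset_span ⟨A.mulVec w, q, f v, ?_⟩
  rw [map_sub, realTensorMap_tmul, realTensorMap_tmul, map_smul]
  congr 2
  funext i
  simp [Matrix.mulVec, dotProduct, Finset.sum_mul, mul_assoc]

/-- The real linear map `A ⊗ f` of `F ^ n ⊗_K V`. -/
def stdTensorMap (A : Matrix (Fin n) (Fin n) F) (f : Module.End K V) :
    Module.End ℝ (StdTensor ι n V) :=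
  Submodule.mapQ _ _ (realTensorMap n A f) (balancedRelations_le_comap ι A f)

theorem stdTensorMap_mk (A : Matrix (Fin n) (Fin n) F) (f : Module.End K V) (w : Fin n → F)
    (v : V) : stdTensorMap ι A f ((balancedRelations ι n V).mkQ (w ⊗ₜ[ℝ] v)) =
      (balancedRelations ι n V).mkQ (A.mulVec w ⊗ₜ[ℝ] f v) := rfl

/-- The tensor product over `K` of a `K`-linear representation `ρ` of `G` on `V` with the standard
representation on `F ^ n` of a matrix group `M`, as a real representation of `G × M`:
`(g, A)` sends `w ⊗ v` to `A w ⊗ ρ g v`. -/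
def stdTensorRep {G : Type*} [Group G] (ρ : G →* Module.End K V)
    (M : Submonoid (Matrix (Fin n) (Fin n) F)) : G × M →* Module.End ℝ (StdTensor ι n V) where
  toFun x := stdTensorMap ι (x.2 : Matrix (Fin n) (Fin n) F) (ρ x.1)
  map_one' := by
    refine Submodule.linearMap_qext _ (TensorProduct.ext' fun w v => ?_)
    simp only [LinearMap.comp_apply, stdTensorMap_mk]
    simp
  map_mul' x y := by
    refine Submodule.linearMap_qext _ (TensorProduct.ext' fun w v => ?_)
    simp only [LinearMap.comp_apply, Module.End.mul_apply, stdTensorMap_mk]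
    simp

end Tensor

/-- The compact symplectic group `Sp(n)`: the quaternionic `n × n` matrices `A` with
`A* A = A A* = 1`. -/
abbrev compactSp (n : ℕ) : Submonoid (Matrix (Fin n) (Fin n) ℍ) :=
  unitary (Matrix (Fin n) (Fin n) ℍ)

end TensorCohomogeneity

end

/-!
The tangent space of the orbit through `p` is spanned by the vectors `X p`, where `X` runs through the
generators of the one-parameter groups of `G × G_n` acting on `F ^ n ⊗_K V`. The cohomogeneity turns
out to be non-increasing in `n` as soon as `n ≥ dim_ℝ V`, and a sequence of natural numbers that is
eventually non-increasing is eventually constant. Monotonicity has two ingredients.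

Genericity. Lift `p` to `P` in `F ^ n ⊗_ℝ V`, and say that `P` has full rank when every element of
`F ⊗_ℝ V` is the contraction of `P` with some row vector. For `n ≥ dim_ℝ V` there is an element `Q` of
full rank (`exists_contraction_surjective`), and `s • P + Q` has full rank for all but finitely many
`s` (`finite_not_contraction_surjective`). The dimension of the orbit of `s • p + q` is at least that
of `p`, again with finitely many exceptions (`finite_finrank_span_velocities_lt`); this uses that a
weakly continuous one-parameter group is differentiable, so that a velocity at `p` extends to a linear
vector field (`exists_generator`). The minimal codimension is therefore attained at some `p` with a
lift of full rank.

Adding a row. Let `i : F ^ n ⊗_K V → F ^ (n + 1) ⊗_K V` append a zero row. It is equivariant along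
`A ↦ diag(A, 1)`, so it maps the tangent space at `p` into the one at `i p`. If `P` has full rank, the
skew-Hermitian matrices with last row `(b, 0)` move `i p` in all directions of the last row, since they
send it to the contraction of `P` with `b`, placed in that row. Hence the normal space at `p` surjects
onto the normal space at `i p` (`codim_stdIncl_le`).
-/

namespace TensorCohomogeneity

/-! ### One-parameter groups are differentiable -/

/-- Averaging `u` over a short interval gives an invertible element `B`, and `u t * B` is the integral
of `u` over a translated interval, hence differentiable in `t`. -/
theorem exists_hasDerivAt_of_continuous_mul {A : Type*} [NormedRing A] [NormedAlgebra ℝ A]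
    [CompleteSpace A] (u : ℝ → A) (hu : Continuous u) (h0 : u 0 = 1)
    (hadd : ∀ s t, u (s + t) = u s * u t) : ∃ X : A, HasDerivAt u X 0 := by
  have hint : ∀ a b : ℝ, IntervalIntegrable u MeasureTheory.volume a b := hu.intervalIntegrable
  have hder : ∀ a : ℝ, HasDerivAt (fun x => ∫ s in (0 : ℝ)..x, u s) (u a) a := fun a =>
    intervalIntegral.integral_hasDerivAt_right (hint 0 a)
      (hu.stronglyMeasurableAtFilter _ _) hu.continuousAt
  obtain ⟨a, hunit⟩ : ∃ a : ℝ, IsUnit (∫ s in (0 : ℝ)..a, u s) := by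
    have hslope := hasDerivAt_iff_tendsto_slope_zero.1 (hder 0)
    rw [h0] at hslope
    have hev := hslope.eventually_mem (Units.isOpen.mem_nhds (isUnit_one : IsUnit (1 : A)))
    obtain ⟨a, ha, ha0⟩ := (hev.and self_mem_nhdsWithin).exists
    replace ha0 : a ≠ 0 := ha0
    refine ⟨a, ?_⟩
    have ha : IsUnit (a⁻¹ • ∫ s in (0 : ℝ)..a, u s) := by simpa using ha
    have := ha.smul (Units.mk0 a ha0)
    rwa [Units.smul_def, Units.val_mk0, smul_smul, mul_inv_cancel₀ ha0, one_smul] at this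
  obtain ⟨B, hB⟩ := hunit
  have key : ∀ t : ℝ, u t = ((∫ s in (0 : ℝ)..(t + a), u s) - ∫ s in (0 : ℝ)..t, u s) * ↑B⁻¹ := by
    intro t
    rw [Units.eq_mul_inv_iff_mul_eq, hB,
      intervalIntegral.integral_interval_sub_left (hint _ _) (hint _ _)]
    have : (fun s => u t * u s) = fun s => u (t + s) := by ext s; rw [hadd]
    have hmul := (ContinuousLinearMap.mul ℝ A (u t)).intervalIntegral_comp_comm (hint 0 a)
    simp only [ContinuousLinearMap.mul_apply'] at hmul
    rw [← hmul, this, intervalIntegral.integral_comp_add_left (fun s => u s) t, add_zero]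
  refine ⟨(u (0 + a) - u 0) * ↑B⁻¹, ?_⟩
  have h1 := (((hder (0 + a)).comp_add_const 0 a).sub (hder 0)).mul_const (↑B⁻¹ : A)
  exact h1.congr_of_eventuallyEq (Filter.Eventually.of_forall key)

/-- A weakly continuous one-parameter group of a finite-dimensional real vector space has an
infinitesimal generator. -/
theorem exists_generator {W : Type*} [AddCommGroup W] [Module ℝ W] [FiniteDimensional ℝ W]
    (U : Multiplicative ℝ →* Module.End ℝ W)
    (hU : ∀ (ℓ : Module.Dual ℝ W) (p : W),
      Continuous fun t : ℝ => ℓ (U (Multiplicative.ofAdd t) p)) :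
    ∃ X : Module.End ℝ W, ∀ (ℓ : Module.Dual ℝ W) (p : W),
      HasDerivAt (fun t : ℝ => ℓ (U (Multiplicative.ofAdd t) p)) (ℓ (X p)) 0 := by
  classical
  let b := Module.finBasis ℝ W
  let e := LinearMap.toMatrixAlgEquiv b
  open scoped Matrix.Norms.Operator in
  obtain ⟨X, hX⟩ := exists_hasDerivAt_of_continuous_mul
    (fun t : ℝ => e (U (Multiplicative.ofAdd t)))
    (by
      refine continuous_pi fun i => continuous_pi fun j => ?_
      simpa [e, LinearMap.toMatrixAlgEquiv_apply] using hU (b.coord i) (b j))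
    (by simp) (fun s t => by simp)
  refine ⟨e.symm X, fun ℓ p => ?_⟩
  let Λ : Matrix (Fin (Module.finrank ℝ W)) (Fin (Module.finrank ℝ W)) ℝ →ₗ[ℝ] ℝ :=
    ℓ ∘ₗ LinearMap.applyₗ p ∘ₗ e.symm.toLinearMap
  open scoped Matrix.Norms.Operator in
  have h : HasDerivAt (fun t : ℝ => Λ (e (U (Multiplicative.ofAdd t)))) (Λ X) 0 :=
    (LinearMap.toContinuousLinearMap Λ).hasFDerivAt.comp_hasDerivAt (0 : ℝ) hX
  simpa [Λ] using h

/-! ### Generic points of a line of linear maps -/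

theorem finite_not_injective_smul_add {Y : Type*} [AddCommGroup Y] [Module ℝ Y]
    [FiniteDimensional ℝ Y] (D : Module.End ℝ Y) :
    {s : ℝ | ¬ Function.Injective (s • (1 : Module.End ℝ Y) + D)}.Finite := by
  refine ((Module.End.finite_spectrum D).preimage (f := fun s : ℝ => -s)
    neg_injective.injOn).subset fun s hs => ?_
  refine Module.End.HasEigenvalue.mem_spectrum ?_
  rw [Set.mem_ofPred_eq, ← LinearMap.ker_eq_bot] at hs
  obtain ⟨y, hy, hy0⟩ := Submodule.exists_mem_ne_zero_of_ne_bot hs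
  refine Module.End.hasEigenvalue_of_hasEigenvector (x := y)
    ⟨Module.End.mem_eigenspace_iff.2 ?_, hy0⟩
  have : s • y + D y = 0 := by simpa using hy
  rw [neg_smul]
  exact eq_neg_of_add_eq_zero_right this

theorem finite_not_injective_add_smul {Y : Type*} [AddCommGroup Y] [Module ℝ Y]
    [FiniteDimensional ℝ Y] (D : Module.End ℝ Y) :
    {s : ℝ | ¬ Function.Injective ((1 : Module.End ℝ Y) + s • D)}.Finite := by
  refine ((finite_not_injective_smul_add D).preimage (f := fun s : ℝ => s⁻¹)
    inv_injective.injOn).subset fun s hs hinj => hs ?_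
  rcases eq_or_ne s 0 with rfl | h0
  · simpa using! Function.injective_id
  · have : (1 : Module.End ℝ Y) + s • D = s • (s⁻¹ • (1 : Module.End ℝ Y) + D) := by
      rw [smul_add, smul_smul, mul_inv_cancel₀ h0, one_smul]
    rw [this]
    exact (smul_right_injective Y h0).comp hinj

/-! ### Tangent spaces of orbits -/

section Tangent

variable {H : Type*} [Monoid H] [TopologicalSpace H] {W : Type*} [AddCommGroup W] [Module ℝ W]

/-- The velocities at `p` of the continuous one-parameter subgroups of `H`. Only the monoid structure
of `H` enters. -/
def velocities (σ : H →* Module.End ℝ W) (p : W) : Set W :=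
  {w : W | ∃ φ : Multiplicative ℝ →* H, Continuous φ ∧
    ∀ ℓ : Module.Dual ℝ W,
      HasDerivAt (fun t : ℝ => ℓ (σ (φ (Multiplicative.ofAdd t)) p)) (ℓ w) 0}

/-- A representation is weakly continuous along one-parameter subgroups when its matrix coefficients
are continuous on each continuous one-parameter subgroup. -/
def WeaklyContinuous (σ : H →* Module.End ℝ W) : Prop :=
  ∀ φ : Multiplicative ℝ →* H, Continuous φ → ∀ (ℓ : Module.Dual ℝ W) (p : W),
    Continuous fun t : ℝ => ℓ (σ (φ (Multiplicative.ofAdd t)) p)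

/-- Each velocity at `p` is the value at `p` of a linear vector field whose value at any other point
is a velocity there. -/
theorem exists_end_of_mem_velocities [FiniteDimensional ℝ W] {σ : H →* Module.End ℝ W}
    (hσ : WeaklyContinuous σ) {p w : W} (hw : w ∈ velocities σ p) :
    ∃ X : Module.End ℝ W, X p = w ∧ ∀ q, X q ∈ velocities σ q := by
  obtain ⟨φ, hφ, hw⟩ := hw
  obtain ⟨X, hX⟩ := exists_generator (σ.comp φ) (hσ φ hφ)
  refine ⟨X, ?_, fun q => ⟨φ, hφ, fun ℓ => hX ℓ q⟩⟩
  rw [← sub_eq_zero, ← Module.forall_dual_apply_eq_zero_iff ℝ]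
  intro ℓ
  rw [map_sub, (hX ℓ p).unique (hw ℓ), sub_self]

/-- Lower semicontinuity of the orbit dimension, along the line of the points `s • p + q`: a basis
`X i p` of the tangent space at `p` stays linearly independent after replacing `p` by `s • p + q`, as
its coordinate matrix becomes `s + D`. -/
theorem finite_finrank_span_velocities_lt [FiniteDimensional ℝ W] {σ : H →* Module.End ℝ W}
    (hσ : WeaklyContinuous σ) (p q : W) :
    {s : ℝ | Module.finrank ℝ (Submodule.span ℝ (velocities σ (s • p + q))) <
      Module.finrank ℝ (Submodule.span ℝ (velocities σ p))}.Finite := by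
  obtain ⟨w, hw, -, hli⟩ := Submodule.exists_fun_fin_finrank_span_eq ℝ (velocities σ p)
  choose X hXp hX using fun i => exists_end_of_mem_velocities hσ (hw i)
  let comb (x : W) := Fintype.linearCombination ℝ fun i => X i x
  have hcomb : LinearMap.ker (comb p) = ⊥ := by
    refine LinearMap.ker_eq_bot'.2 fun c hc => funext fun i => ?_
    refine Fintype.linearIndependent_iff.1 hli c ?_ i
    simpa [comb, Fintype.linearCombination_apply, hXp] using hc
  obtain ⟨π, hπ⟩ := (comb p).exists_leftInverse_of_injective hcomb
  refine (finite_not_injective_smul_add (π ∘ₗ comb q)).subset fun s hs hinj => ?_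
  have hsplit : π ∘ₗ comb (s • p + q) = s • (1 : Module.End ℝ (Fin _ → ℝ)) + π ∘ₗ comb q := by
    have : comb (s • p + q) = s • comb p + comb q := by
      ext i
      simp [comb]
    rw [this, LinearMap.comp_add, LinearMap.comp_smul, hπ]
    rfl
  rw [← hsplit] at hinj
  have hinj' : Function.Injective (comb (s • p + q)) := Function.Injective.of_comp hinj
  have hle := LinearMap.finrank_range_of_inj hinj'
  rw [Module.finrank_fin_fun] at hle
  refine absurd (Set.mem_ofPred_eq ▸ hs) (not_lt.2 (hle ▸ Submodule.finrank_mono ?_))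
  rw [Fintype.range_linearCombination]
  exact Submodule.span_mono (Set.range_subset_iff.2 fun i => hX i _)

end Tangent

/-! ### Adding a row -/

section Row

variable {F : Type*} [NormedRing F]

/-- Appends an entry `0` to a column vector. -/
def appendZero (F : Type*) [NormedRing F] [NormedAlgebra ℝ F] (n : ℕ) :
    (Fin n → F) →ₗ[ℝ] (Fin (n + 1) → F) where
  toFun w := Sum.elim w 0 ∘ finSumFinEquiv.symm
  map_add' w w' := by
    ext i
    simp only [Function.comp_apply, Pi.add_apply]
    rcases finSumFinEquiv.symm i <;> simp
  map_smul' r w := by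
    ext i
    simp only [Function.comp_apply, Pi.smul_apply, RingHom.id_apply]
    rcases finSumFinEquiv.symm i <;> simp

/-- The column vector with last entry `x` and all others `0`. -/
def lastEntry (F : Type*) [NormedRing F] [NormedAlgebra ℝ F] (n : ℕ) :
    F →ₗ[ℝ] (Fin (n + 1) → F) where
  toFun x := Sum.elim 0 (fun _ => x) ∘ finSumFinEquiv.symm
  map_add' w w' := by
    ext i
    simp only [Function.comp_apply, Pi.add_apply]
    rcases finSumFinEquiv.symm i <;> simp
  map_smul' r w := by
    ext i
    simp only [Function.comp_apply, Pi.smul_apply, RingHom.id_apply]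
    rcases finSumFinEquiv.symm i <;> simp

theorem appendZero_mul [NormedAlgebra ℝ F] (n : ℕ) (w : Fin n → F) (a : F) :
    appendZero F n (fun i => w i * a) = fun i => appendZero F n w i * a := by
  ext i
  simp only [appendZero, LinearMap.coe_mk, AddHom.coe_mk, Function.comp_apply]
  rcases finSumFinEquiv.symm i <;> simp

theorem exists_eq_appendZero_add_lastEntry [NormedAlgebra ℝ F] (n : ℕ) (w : Fin (n + 1) → F) :
    ∃ w' x, w = appendZero F n w' + lastEntry F n x := by
  refine ⟨fun i => w (finSumFinEquiv (Sum.inl i)), w (finSumFinEquiv (Sum.inr 0)), ?_⟩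
  ext i
  rcases finSumFinEquiv.surjective i with ⟨i | i, rfl⟩
  · simp [appendZero, lastEntry, -finSumFinEquiv_apply_left]
  · obtain rfl := Subsingleton.elim i 0
    simp [appendZero, lastEntry, -finSumFinEquiv_apply_right]

/-- The block matrix `diag(A, 1)`. -/
def appendOne (F : Type*) [NormedRing F] (n : ℕ) :
    Matrix (Fin n) (Fin n) F →* Matrix (Fin (n + 1)) (Fin (n + 1)) F where
  toFun A := (Matrix.fromBlocks A 0 0 1).submatrix finSumFinEquiv.symm finSumFinEquiv.symm
  map_one' := by rw [Matrix.fromBlocks_one, Matrix.submatrix_one_equiv]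
  map_mul' A B := by
    rw [Matrix.submatrix_mul_equiv, Matrix.fromBlocks_multiply]
    simp

theorem appendOne_apply (n : ℕ) (A : Matrix (Fin n) (Fin n) F) : appendOne F n A =
    (Matrix.fromBlocks A 0 0 1).submatrix finSumFinEquiv.symm finSumFinEquiv.symm := rfl

theorem continuous_appendOne (n : ℕ) : Continuous (appendOne F n) := by
  simp_rw [funext (appendOne_apply (F := F) n)]
  fun_prop

theorem appendOne_mulVec [NormedAlgebra ℝ F] (n : ℕ) (A : Matrix (Fin n) (Fin n) F) (w : Fin n → F) :
    (appendOne F n A).mulVec (appendZero F n w) = appendZero F n (A.mulVec w) := by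
  change _ = Sum.elim (A.mulVec w) 0 ∘ finSumFinEquiv.symm
  change ((Matrix.fromBlocks A 0 0 1).submatrix _ _).mulVec
    (Sum.elim w 0 ∘ finSumFinEquiv.symm) = _
  rw [Matrix.submatrix_mulVec_equiv]
  simp [Matrix.fromBlocks_mulVec, Function.comp_assoc]

theorem appendOne_conjTranspose [StarRing F] (n : ℕ) (A : Matrix (Fin n) (Fin n) F) :
    (appendOne F n A).conjTranspose = appendOne F n A.conjTranspose := by
  simp [appendOne_apply, Matrix.conjTranspose_submatrix, Matrix.fromBlocks_conjTranspose]

/-- The skew-Hermitian matrix with last row `(b, 0)`, last column `(-b*, 0)` and zeros elsewhere. -/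
def skewRow [StarRing F] {n : ℕ} (b : Fin n → F) : Matrix (Fin (n + 1)) (Fin (n + 1)) F :=
  (Matrix.fromBlocks 0 (-(Matrix.replicateRow (Fin 1) b).conjTranspose)
    (Matrix.replicateRow (Fin 1) b) 0).submatrix finSumFinEquiv.symm finSumFinEquiv.symm

theorem skewRow_conjTranspose [StarRing F] {n : ℕ} (b : Fin n → F) :
    (skewRow b).conjTranspose = -skewRow b := by
  rw [skewRow, Matrix.conjTranspose_submatrix, Matrix.fromBlocks_conjTranspose,
    show ∀ X : Matrix (Fin n ⊕ Fin 1) (Fin n ⊕ Fin 1) F, -X.submatrix finSumFinEquiv.symm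
      finSumFinEquiv.symm = (-X).submatrix finSumFinEquiv.symm finSumFinEquiv.symm from
      fun _ => rfl, Matrix.fromBlocks_neg]
  simp

theorem skewRow_mulVec [NormedAlgebra ℝ F] [StarRing F] {n : ℕ} (b w : Fin n → F) :
    (skewRow b).mulVec (appendZero F n w) = lastEntry F n (b ⬝ᵥ w) := by
  change _ = Sum.elim (0 : Fin n → F) (fun _ => b ⬝ᵥ w) ∘ finSumFinEquiv.symm
  change ((Matrix.fromBlocks _ _ _ _).submatrix _ _).mulVec
    (Sum.elim w 0 ∘ finSumFinEquiv.symm) = _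
  rw [Matrix.submatrix_mulVec_equiv]
  simp only [Equiv.symm_symm, Function.comp_assoc, Equiv.symm_comp_self, Function.comp_id,
    Matrix.fromBlocks_mulVec, Sum.elim_comp_inl, Sum.elim_comp_inr, Matrix.zero_mulVec,
    Matrix.mulVec_zero, add_zero]
  rfl

end Row

/-! ### Contraction with a row vector -/

section Contraction

variable {F : Type*} [NormedRing F] [NormedAlgebra ℝ F] (V : Type*) [AddCommGroup V] [Module ℝ V]

/-- The linear map `b ↦ (w ⊗ v ↦ (b ⬝ᵥ w) ⊗ v)` from row vectors `b` to maps `F ^ n ⊗ V → F ⊗ V`. -/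
noncomputable def contraction (F : Type*) [NormedRing F] [NormedAlgebra ℝ F] (n : ℕ) :
    (Fin n → F) →ₗ[ℝ] ((Fin n → F) ⊗[ℝ] V) →ₗ[ℝ] (F ⊗[ℝ] V) :=
  LinearMap.rTensorHom V ∘ₗ LinearMap.mk₂ ℝ (fun b w : Fin n → F => b ⬝ᵥ w)
    (fun _ _ _ => add_dotProduct _ _ _) (fun _ _ _ => smul_dotProduct _ _ _)
    (fun _ _ _ => dotProduct_add _ _ _) (fun _ _ _ => dotProduct_smul _ _ _)

variable {V}

theorem contraction_tmul {n : ℕ} (b w : Fin n → F) (v : V) :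
    contraction V F n b (w ⊗ₜ v) = (b ⬝ᵥ w) ⊗ₜ[ℝ] v := rfl

/-- If `n` is at least the dimension of `V`, then `F ^ n ⊗ V` has an element of full rank: the sum of
the `e k ⊗ v k` for a basis `v` of `V`. -/
theorem exists_contraction_surjective [FiniteDimensional ℝ V] {n : ℕ}
    (hn : Module.finrank ℝ V ≤ n) :
    ∃ Q : (Fin n → F) ⊗[ℝ] V, Function.Surjective ((contraction V F n).flip Q) := by
  let v := Module.finBasis ℝ V
  refine ⟨∑ k, (Pi.single (Fin.castLE hn k) (1 : F)) ⊗ₜ v k, ?_⟩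
  rw [← LinearMap.range_eq_top, eq_top_iff, ← TensorProduct.span_tmul_eq_top, Submodule.span_le]
  rintro _ ⟨x, y, rfl⟩
  rw [← v.sum_repr y, TensorProduct.tmul_sum]
  refine Submodule.sum_mem _ fun k _ => ?_
  rw [TensorProduct.tmul_smul]
  refine Submodule.smul_mem _ _ ⟨Pi.single (Fin.castLE hn k) x, ?_⟩
  rw [LinearMap.flip_apply, map_sum]
  simp only [contraction_tmul, single_dotProduct]
  rw [Finset.sum_eq_single k]
  · simp
  · intro j _ hj
    rw [Pi.single_eq_of_ne, mul_zero, TensorProduct.zero_tmul]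
    simpa using hj.symm
  · simp

/-- Full rank is a generic condition on the line of the points `s • P + Q`. -/
theorem finite_not_contraction_surjective [FiniteDimensional ℝ F] [FiniteDimensional ℝ V] {n : ℕ}
    (P : (Fin n → F) ⊗[ℝ] V) {Q : (Fin n → F) ⊗[ℝ] V}
    (hQ : Function.Surjective ((contraction V F n).flip Q)) :
    {s : ℝ | ¬ Function.Surjective ((contraction V F n).flip (s • P + Q))}.Finite := by
  obtain ⟨S, hS⟩ := ((contraction V F n).flip Q).exists_rightInverse_of_surjective
    (LinearMap.range_eq_top.2 hQ)
  refine (finite_not_injective_add_smul ((contraction V F n).flip P ∘ₗ S)).subset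
    fun s hs hinj => hs ?_
  have hsplit : (contraction V F n).flip (s • P + Q) ∘ₗ S =
      (1 : Module.End ℝ (F ⊗[ℝ] V)) + s • ((contraction V F n).flip P ∘ₗ S) := by
    rw [map_add, map_smul, LinearMap.add_comp, hS, add_comm]
    rfl
  rw [← hsplit] at hinj
  exact Function.Surjective.of_comp (g := S) (LinearMap.injective_iff_surjective.1 hinj)

end Contraction

/-! ### The tensor representations -/

section Rep

variable {F : Type*} [NormedRing F] [NormedAlgebra ℝ F]
  {K : Type*} [Ring K] [Algebra ℝ K] (ι : K →ₐ[ℝ] F)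
  {V : Type*} [NormedAddCommGroup V] [NormedSpace ℝ V] [Module K V]

theorem stdTensor_induction {n : ℕ} {p : StdTensor ι n V → Prop} (x : StdTensor ι n V)
    (zero : p 0) (tmul : ∀ (w : Fin n → F) (v : V), p ((balancedRelations ι n V).mkQ (w ⊗ₜ v)))
    (add : ∀ x y, p x → p y → p (x + y)) : p x := by
  obtain ⟨P, rfl⟩ := (balancedRelations ι n V).mkQ_surjective x
  induction P with
  | zero => simpa using zero
  | tmul w v => exact tmul w v
  | add x y hx hy => rw [map_add]; exact add _ _ hx hy

theorem weaklyContinuous_stdTensorRep [IsScalarTower ℝ K V] [FiniteDimensional ℝ F]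
    [FiniteDimensional ℝ V] {G : Type*} [Group G] [TopologicalSpace G] {n : ℕ} (ρ : G →* Module.End K V)
    (hρ : ∀ v : V, Continuous fun g : G => ρ g v) (M : Submonoid (Matrix (Fin n) (Fin n) F)) :
    WeaklyContinuous (stdTensorRep ι ρ M) := by
  intro φ hφ ℓ p
  induction p using stdTensor_induction with
  | zero => simpa using continuous_const
  | add x y hx hy => simpa using! hx.add hy
  | tmul w v =>
    let B : (Fin n → F) →ₗ[ℝ] V →ₗ[ℝ] ℝ :=
      (TensorProduct.mk ℝ (Fin n → F) V).compr₂ (ℓ ∘ₗ (balancedRelations ι n V).mkQ)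
    have hφ' : Continuous fun t : ℝ => φ (Multiplicative.ofAdd t) := hφ.comp continuous_ofAdd
    have h1 : Continuous fun t : ℝ =>
        ((φ (Multiplicative.ofAdd t)).2 : Matrix (Fin n) (Fin n) F).mulVec w :=
      (continuous_subtype_val.comp (continuous_snd.comp hφ')).matrix_mulVec continuous_const
    have h2 : Continuous fun t : ℝ => ρ (φ (Multiplicative.ofAdd t)).1 v :=
      (hρ v).comp (continuous_fst.comp hφ')
    exact (B.toContinuousBilinearMap.continuous.comp h1).clm_apply h2

/-- The inclusion `F ^ n ⊗_K V → F ^ (n + 1) ⊗_K V`. -/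
noncomputable def stdIncl (n : ℕ) : StdTensor ι n V →ₗ[ℝ] StdTensor ι (n + 1) V :=
  Submodule.mapQ _ _ (LinearMap.rTensor V (appendZero F n)) <| by
    refine Submodule.span_le.2 ?_
    rintro _ ⟨w, q, v, rfl⟩
    refine Submodule.subset_span ⟨appendZero F n w, q, v, ?_⟩
    rw [map_sub, LinearMap.rTensor_tmul, LinearMap.rTensor_tmul, appendZero_mul]

/-- The map `F ⊗ V → F ^ (n + 1) ⊗_K V` that places a tensor in the last row. -/
noncomputable def stdLast (n : ℕ) : F ⊗[ℝ] V →ₗ[ℝ] StdTensor ι (n + 1) V :=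
  (balancedRelations ι (n + 1) V).mkQ ∘ₗ LinearMap.rTensor V (lastEntry F n)

theorem stdIncl_mk (n : ℕ) (w : Fin n → F) (v : V) :
    stdIncl ι n ((balancedRelations ι n V).mkQ (w ⊗ₜ v)) =
      (balancedRelations ι (n + 1) V).mkQ (appendZero F n w ⊗ₜ v) := rfl

theorem range_stdIncl_sup_range_stdLast (n : ℕ) :
    LinearMap.range (stdIncl ι (V := V) n) ⊔ LinearMap.range (stdLast ι (V := V) n) = ⊤ := by
  rw [eq_top_iff]
  rintro x -
  induction x using stdTensor_induction with
  | zero => exact Submodule.zero_mem _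
  | add x y hx hy => exact Submodule.add_mem _ hx hy
  | tmul w v =>
    obtain ⟨w', x, rfl⟩ := exists_eq_appendZero_add_lastEntry n w
    rw [TensorProduct.add_tmul, map_add]
    exact Submodule.add_mem_sup ⟨_, stdIncl_mk ι n w' v⟩ ⟨x ⊗ₜ v, rfl⟩

theorem stdTensorMap_appendOne_stdIncl [IsScalarTower ℝ K V] {n : ℕ} (A : Matrix (Fin n) (Fin n) F)
    (f : Module.End K V) (x : StdTensor ι n V) :
    stdTensorMap ι (appendOne F n A) f (stdIncl ι n x) = stdIncl ι n (stdTensorMap ι A f x) := by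
  induction x using stdTensor_induction with
  | zero => simp
  | add x y hx hy => simp only [map_add, hx, hy]
  | tmul w v => rw [stdTensorMap_mk, stdIncl_mk, stdIncl_mk, stdTensorMap_mk, appendOne_mulVec]

theorem stdTensorMap_skewRow_stdIncl [IsScalarTower ℝ K V] [StarRing F] {n : ℕ}
    (b : Fin n → F) (P : (Fin n → F) ⊗[ℝ] V) :
    stdTensorMap ι (skewRow b) 1 (stdIncl ι n ((balancedRelations ι n V).mkQ P)) =
      stdLast ι n (contraction V F n b P) := by
  induction P with
  | zero => simp
  | add x y hx hy => simp only [map_add, hx, hy]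
  | tmul w v => rw [stdIncl_mk, stdTensorMap_mk, skewRow_mulVec]; rfl

open scoped Matrix.Norms.Operator in
theorem hasDerivAt_apply_exp_smul [FiniteDimensional ℝ F] {n : ℕ}
    (Λ : Matrix (Fin n) (Fin n) F →ₗ[ℝ] ℝ) (A : Matrix (Fin n) (Fin n) F) :
    HasDerivAt (fun t : ℝ => Λ (NormedSpace.exp (t • A))) (Λ A) 0 := by
  have : CompleteSpace F := FiniteDimensional.complete ℝ F
  have h := (LinearMap.toContinuousLinearMap Λ).hasFDerivAt.comp_hasDerivAt (0 : ℝ)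
    (hasDerivAt_exp_smul_const (𝕂 := ℝ) A (0 : ℝ))
  rw [zero_smul, NormedSpace.exp_zero, one_mul] at h
  exact h

theorem hasDerivAt_stdTensorMap_exp [IsScalarTower ℝ K V] [FiniteDimensional ℝ F] {n : ℕ}
    (A : Matrix (Fin n) (Fin n) F) (ℓ : Module.Dual ℝ (StdTensor ι n V)) (x : StdTensor ι n V) :
    HasDerivAt (fun t : ℝ => ℓ (stdTensorMap ι (NormedSpace.exp (t • A)) 1 x))
      (ℓ (stdTensorMap ι A 1 x)) 0 := by
  induction x using stdTensor_induction with
  | zero => simpa using hasDerivAt_const (0 : ℝ) (0 : ℝ)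
  | add x y hx hy => simpa using! hx.add hy
  | tmul w v =>
    exact hasDerivAt_apply_exp_smul
      { toFun := fun B => ℓ ((balancedRelations ι n V).mkQ (B.mulVec w ⊗ₜ v))
        map_add' := fun B C => by rw [Matrix.add_mulVec, TensorProduct.add_tmul, map_add, map_add]
        map_smul' := fun r B => by
          rw [Matrix.smul_mulVec, ← TensorProduct.smul_tmul', map_smul, map_smul]; rfl } A

end Rep

theorem finrank_quotient_le_finrank_quotient {W : Type*} [AddCommGroup W] [Module ℝ W]
    [FiniteDimensional ℝ W] {S T : Submodule ℝ W}
    (h : Module.finrank ℝ S ≤ Module.finrank ℝ T) :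
    Module.finrank ℝ (W ⧸ T) ≤ Module.finrank ℝ (W ⧸ S) := by
  have h1 := S.finrank_quotient_add_finrank
  have h2 := T.finrank_quotient_add_finrank
  lia

/-! ### Monotonicity of the cohomogeneity -/

section Monotone

variable {F : Type*} [NormedRing F] [NormedAlgebra ℝ F]
  {K : Type*} [Ring K] [Algebra ℝ K] (ι : K →ₐ[ℝ] F)
  {V : Type*} [NormedAddCommGroup V] [NormedSpace ℝ V] [Module K V] [IsScalarTower ℝ K V]
  {G : Type*} [Group G] [TopologicalSpace G]
  {M : ∀ n, Submonoid (Matrix (Fin n) (Fin n) F)}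

theorem stdIncl_mem_velocities (ρ : G →* Module.End K V)
    (hM : ∀ n, ∀ A ∈ M n, appendOne F n A ∈ M (n + 1)) {n : ℕ} {p w : StdTensor ι n V}
    (hw : w ∈ velocities (stdTensorRep ι ρ (M n)) p) :
    stdIncl ι n w ∈ velocities (stdTensorRep ι ρ (M (n + 1))) (stdIncl ι n p) := by
  obtain ⟨φ, hφ, hder⟩ := hw
  let j : M n →* M (n + 1) := ((appendOne F n).comp (M n).subtype).codRestrict _
    fun A => hM n A A.2
  have hj : Continuous j :=
    ((continuous_appendOne n).comp continuous_subtype_val).subtype_mk _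
  refine ⟨((MonoidHom.id G).prodMap j).comp φ, (continuous_id.prodMap hj).comp hφ, fun ℓ => ?_⟩
  have h := hder (ℓ ∘ₗ stdIncl ι n)
  refine h.congr_of_eventuallyEq (Filter.Eventually.of_forall fun t => ?_)
  exact congrArg ℓ (stdTensorMap_appendOne_stdIncl ι _ _ p)

variable [FiniteDimensional ℝ F] [StarRing F] [StarModule ℝ F]

theorem stdLast_mem_velocities (ρ : G →* Module.End K V)
    (hexp : ∀ n (A : Matrix (Fin n) (Fin n) F), A.conjTranspose = -A → NormedSpace.exp A ∈ M n)
    {n : ℕ} (b : Fin n → F) (P : (Fin n → F) ⊗[ℝ] V) :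
    stdLast ι n (contraction V F n b P) ∈ velocities (stdTensorRep ι ρ (M (n + 1)))
      (stdIncl ι n ((balancedRelations ι n V).mkQ P)) := by
  have : CompleteSpace F := FiniteDimensional.complete ℝ F
  let _ : NormedAlgebra ℚ F := NormedAlgebra.restrictScalars ℚ ℝ F
  let φ : Multiplicative ℝ →* M (n + 1) :=
    { toFun := fun t => ⟨NormedSpace.exp (t.toAdd • skewRow b), hexp _ _ (by
        rw [Matrix.conjTranspose_smul, skewRow_conjTranspose, smul_neg, star_trivial])⟩
      map_one' := by ext1; simp
      map_mul' := fun s t => by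
        ext1
        simp only [toAdd_mul, add_smul, Submonoid.coe_mul]
        exact Matrix.exp_add_of_commute _ _
          (((Commute.refl (skewRow b)).smul_left s.toAdd).smul_right t.toAdd) }
  have hφ : Continuous φ := by
    refine Continuous.subtype_mk ?_ _
    open scoped Matrix.Norms.Operator in
    exact NormedSpace.exp_continuous.comp (continuous_toAdd.smul continuous_const)
  refine ⟨(MonoidHom.inr G (M (n + 1))).comp φ, ?_, fun ℓ => ?_⟩
  · exact continuous_const.prodMk hφ
  · rw [← stdTensorMap_skewRow_stdIncl]
    refine (hasDerivAt_stdTensorMap_exp ι (skewRow b) ℓ _).congr_of_eventuallyEq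
      (Filter.Eventually.of_forall fun t => ?_)
    simp [stdTensorRep, φ]

variable [FiniteDimensional ℝ V]

/-- At a point of full rank, adding a row does not increase the codimension of the orbit: the
one-parameter groups that rotate the rows of the point into the new row make up for the new
dimensions. -/
theorem codim_stdIncl_le (ρ : G →* Module.End K V)
    (hM : ∀ n, ∀ A ∈ M n, appendOne F n A ∈ M (n + 1))
    (hexp : ∀ n (A : Matrix (Fin n) (Fin n) F), A.conjTranspose = -A → NormedSpace.exp A ∈ M n)
    {n : ℕ} {P : (Fin n → F) ⊗[ℝ] V}
    (hP : Function.Surjective ((contraction V F n).flip P)) :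
    Module.finrank ℝ (StdTensor ι (n + 1) V ⧸ Submodule.span ℝ (velocities
      (stdTensorRep ι ρ (M (n + 1))) (stdIncl ι n ((balancedRelations ι n V).mkQ P)))) ≤
    Module.finrank ℝ (StdTensor ι n V ⧸ Submodule.span ℝ (velocities
      (stdTensorRep ι ρ (M n)) ((balancedRelations ι n V).mkQ P))) := by
  set p := (balancedRelations ι n V).mkQ P
  set T' := Submodule.span ℝ (velocities (stdTensorRep ι ρ (M (n + 1))) (stdIncl ι n p))
  have hle : Submodule.span ℝ (velocities (stdTensorRep ι ρ (M n)) p) ≤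
      T'.comap (stdIncl ι n) :=
    Submodule.span_le.2 fun w hw => Submodule.subset_span (stdIncl_mem_velocities ι ρ hM hw)
  have hlast : LinearMap.range (stdLast ι (V := V) n) ≤ T' := by
    rintro _ ⟨u, rfl⟩
    obtain ⟨b, rfl⟩ := hP u
    exact Submodule.subset_span (stdLast_mem_velocities ι ρ hexp b P)
  refine LinearMap.finrank_le_finrank_of_surjective
    (f := Submodule.mapQ _ T' (stdIncl ι n) hle) ?_
  intro y
  obtain ⟨y, rfl⟩ := T'.mkQ_surjective y
  obtain ⟨_, ⟨x, rfl⟩, z, hz, rfl⟩ := Submodule.mem_sup.1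
    ((range_stdIncl_sup_range_stdLast ι n).ge (Submodule.mem_top (x := y)))
  refine ⟨Submodule.Quotient.mk x, ?_⟩
  rw [map_add, Submodule.mkQ_apply T' z, (Submodule.Quotient.mk_eq_zero T').2 (hlast hz), add_zero]
  rfl

/-- For `n` at least the dimension of `V`, the minimal codimension of the orbits is attained at a
point of full rank, so that it does not increase with `n`. -/
theorem iInf_codim_succ_le (ρ : G →* Module.End K V) (hρ : ∀ v : V, Continuous fun g : G => ρ g v)
    (hM : ∀ n, ∀ A ∈ M n, appendOne F n A ∈ M (n + 1))
    (hexp : ∀ n (A : Matrix (Fin n) (Fin n) F), A.conjTranspose = -A → NormedSpace.exp A ∈ M n)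
    {n : ℕ} (hn : Module.finrank ℝ V ≤ n) :
    ⨅ p, Module.finrank ℝ (StdTensor ι (n + 1) V ⧸ Submodule.span ℝ (velocities
      (stdTensorRep ι ρ (M (n + 1))) p)) ≤
    ⨅ p, Module.finrank ℝ (StdTensor ι n V ⧸ Submodule.span ℝ (velocities
      (stdTensorRep ι ρ (M n)) p)) := by
  set R := balancedRelations ι n V
  have hmin := ciInf_mem fun p => Module.finrank ℝ (StdTensor ι n V ⧸ Submodule.span ℝ
    (velocities (stdTensorRep ι ρ (M n)) p))
  obtain ⟨p, hp⟩ := hmin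
  obtain ⟨P, rfl⟩ := R.mkQ_surjective p
  obtain ⟨Q, hQ⟩ := exists_contraction_surjective (F := F) hn
  -- All but finitely many points `s • P + Q` have full rank and an orbit of at least the
  -- dimension of the orbit of `P`, both taken in `F ^ n ⊗_K V`.
  obtain ⟨s, hs⟩ := ((finite_not_contraction_surjective P hQ).union
    (finite_finrank_span_velocities_lt (weaklyContinuous_stdTensorRep ι ρ hρ (M n))
      (R.mkQ P) (R.mkQ Q))).infinite_compl.nonempty
  obtain ⟨hs1, hs2⟩ := not_or.1 hs
  rw [← hp]
  refine (ciInf_le (OrderBot.bddBelow _) _).trans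
    ((codim_stdIncl_le ι ρ hM hexp (not_not.1 hs1)).trans ?_)
  replace hs2 := not_lt.1 (Set.mem_ofPred_eq ▸ hs2)
  rw [← map_smul, ← map_add] at hs2
  exact finrank_quotient_le_finrank_quotient hs2

theorem eventually_const_of_succ_le {f : ℕ → ℕ} {d : ℕ} (hf : ∀ n, d ≤ n → f (n + 1) ≤ f n) :
    ∃ N c : ℕ, ∀ n, N ≤ n → f n = c := by
  obtain ⟨N, hN⟩ := ciInf_mem fun n => f (d + n)
  refine ⟨d + N, f (d + N), fun n hn => le_antisymm ?_ ?_⟩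
  · induction n, hn using Nat.le_induction with
    | base => rfl
    | succ n hn ih => exact (hf n (by lia)).trans ih
  · obtain ⟨k, rfl⟩ := Nat.exists_eq_add_of_le (show d ≤ n by lia)
    exact hN.trans_le (ciInf_le (OrderBot.bddBelow _) k)

/-- The stabilization of the cohomogeneity, for any family of matrix groups `M n` that is closed under
`A ↦ diag(A, 1)` and contains the exponentials of the skew-Hermitian matrices. -/
theorem eventually_const_iInf_codim (ρ : G →* Module.End K V)
    (hρ : ∀ v : V, Continuous fun g : G => ρ g v)
    (hM : ∀ n, ∀ A ∈ M n, appendOne F n A ∈ M (n + 1))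
    (hexp : ∀ n (A : Matrix (Fin n) (Fin n) F), A.conjTranspose = -A →
      NormedSpace.exp A ∈ M n) :
    ∃ N c : ℕ, ∀ n, N ≤ n → ⨅ p, Module.finrank ℝ (StdTensor ι n V ⧸ Submodule.span ℝ (velocities
      (stdTensorRep ι ρ (M n)) p)) = c :=
  eventually_const_of_succ_le fun _ hn => iInf_codim_succ_le ι ρ hρ hM hexp hn

end Monotone

/-! ### The classical groups -/

theorem appendOne_mem_unitary {F : Type*} [NormedRing F] [StarRing F] {n : ℕ}
    {A : Matrix (Fin n) (Fin n) F} (hA : A ∈ unitary (Matrix (Fin n) (Fin n) F)) :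
    appendOne F n A ∈ unitary (Matrix (Fin (n + 1)) (Fin (n + 1)) F) := by
  rw [Unitary.mem_iff, Matrix.star_eq_conjTranspose] at hA ⊢
  rw [appendOne_conjTranspose, ← map_mul, ← map_mul, hA.1, hA.2, map_one]
  exact ⟨rfl, rfl⟩

theorem exp_mem_unitary_of_conjTranspose_eq_neg {F : Type*} [NormedRing F] [NormedAlgebra ℝ F]
    [CompleteSpace F] [StarRing F] [ContinuousStar F] {n : ℕ} {A : Matrix (Fin n) (Fin n) F}
    (hA : A.conjTranspose = -A) : NormedSpace.exp A ∈ unitary (Matrix (Fin n) (Fin n) F) := by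
  let _ : NormedAlgebra ℚ F := NormedAlgebra.restrictScalars ℚ ℝ F
  rw [Unitary.mem_iff, Matrix.star_eq_conjTranspose, ← Matrix.exp_conjTranspose, hA,
    ← Matrix.exp_add_of_commute _ _ (Commute.refl A).neg_left,
    ← Matrix.exp_add_of_commute _ _ (Commute.refl A).neg_right]
  simp

theorem appendOne_mem_specialOrthogonalGroup {n : ℕ} {A : Matrix (Fin n) (Fin n) ℝ}
    (hA : A ∈ Matrix.specialOrthogonalGroup (Fin n) ℝ) :
    appendOne ℝ n A ∈ Matrix.specialOrthogonalGroup (Fin (n + 1)) ℝ := by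
  refine ⟨appendOne_mem_unitary hA.1, ?_⟩
  change (appendOne ℝ n A).det = 1
  rw [appendOne_apply, Matrix.det_submatrix_equiv_self, Matrix.det_fromBlocks_zero₂₁,
    Matrix.det_one, mul_one]
  exact hA.2

/-- The determinant of the orthogonal matrix `exp A` is `1` since `exp A` is the square of the
orthogonal matrix `exp (A / 2)`. -/
theorem exp_mem_specialOrthogonalGroup {n : ℕ} {A : Matrix (Fin n) (Fin n) ℝ}
    (hA : A.conjTranspose = -A) :
    NormedSpace.exp A ∈ Matrix.specialOrthogonalGroup (Fin n) ℝ := by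
  refine ⟨exp_mem_unitary_of_conjTranspose_eq_neg hA, ?_⟩
  change (NormedSpace.exp A).det = 1
  have hhalf := (Unitary.mem_iff.1 (exp_mem_unitary_of_conjTranspose_eq_neg
    (A := (1 / 2 : ℝ) • A) (by rw [Matrix.conjTranspose_smul, hA, smul_neg, star_trivial]))).1
  have hsq : NormedSpace.exp A =
      NormedSpace.exp ((1 / 2 : ℝ) • A) * NormedSpace.exp ((1 / 2 : ℝ) • A) := by
    rw [← Matrix.exp_add_of_commute _ _ (Commute.refl _), ← add_smul]
    norm_num
  have hdet := congrArg Matrix.det hhalf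
  rw [Matrix.star_eq_conjTranspose, Matrix.det_mul, Matrix.det_conjTranspose, star_trivial,
    Matrix.det_one] at hdet
  rw [hsq, Matrix.det_mul, hdet]

end TensorCohomogeneity

theorem mainTheorem4
    {E : Type*} [NormedAddCommGroup E] [NormedSpace ℝ E] [FiniteDimensional ℝ E]
    {G : Type*} [TopologicalSpace G] [ChartedSpace E G] [Group G] [LieGroup 𝓘(ℝ, E) ∞ G]
    [CompactSpace G] [T2Space G]
    {K : Type*} [DivisionRing K] [Algebra ℝ K]
    {V : Type*} [NormedAddCommGroup V] [NormedSpace ℝ V] [FiniteDimensional ℝ V]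
    [Module K V] [IsScalarTower ℝ K V]
    (ρ : G →* Module.End K V) (hρ : ∀ v : V, Continuous fun g : G => ρ g v) :
    (∀ ι : K →ₐ[ℝ] ℝ, ∃ N c : ℕ, ∀ n : ℕ, N ≤ n →
      TensorCohomogeneity.cohomogeneity (TensorCohomogeneity.stdTensorRep ι ρ
        (Matrix.specialOrthogonalGroup (Fin n) ℝ)) = c) ∧
    (∀ ι : K →ₐ[ℝ] ℂ, ∃ N c : ℕ, ∀ n : ℕ, N ≤ n →
      TensorCohomogeneity.cohomogeneity (TensorCohomogeneity.stdTensorRep ι ρ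
        (Matrix.unitaryGroup (Fin n) ℂ)) = c) ∧
    (∀ ι : K →ₐ[ℝ] ℍ, ∃ N c : ℕ, ∀ n : ℕ, N ≤ n →
      TensorCohomogeneity.cohomogeneity (TensorCohomogeneity.stdTensorRep ι ρ
        (TensorCohomogeneity.compactSp n)) = c) := by
  open TensorCohomogeneity in
  refine ⟨fun ι => ?_, fun ι => ?_, fun ι => ?_⟩
  -- `cohomogeneity` is by definition the infimum of the codimensions of the spans of `velocities`.
  · exact eventually_const_iInf_codim (M := fun n => Matrix.specialOrthogonalGroup (Fin n) ℝ) ι ρ hρ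
      (fun _ _ => appendOne_mem_specialOrthogonalGroup) fun _ _ => exp_mem_specialOrthogonalGroup
  · exact eventually_const_iInf_codim (M := fun n => Matrix.unitaryGroup (Fin n) ℂ) ι ρ hρ
      (fun _ _ => appendOne_mem_unitary) fun _ _ => exp_mem_unitary_of_conjTranspose_eq_neg
  · have : StarModule ℝ ℍ := ⟨fun r a => Quaternion.star_smul r a⟩
    exact eventually_const_iInf_codim (M := compactSp) ι ρ hρ
      (fun _ _ => appendOne_mem_unitary) fun _ _ => exp_mem_unitary_of_conjTranspose_eq_neg
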